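/- Let $1<\beta\in\mathbb{R}$, $\zeta\in\mathbb{C}\setminus\mathbb{R}$ with $|\zeta|=1$, and $\xi,\eta_1,\eta_2\in\mathbb{C}$ with $\eta_1/\eta_2\notin\mathbb{R}$. Let $\mathcal{L}=\mathbb{Z}\eta_1+\mathbb{Z}\eta_2$ and $\mathcal{X}=\{\xi+x\eta_1+y\eta_2 : x,y\in[0,1)\}$. The rotational beta transformation $T:\mathcal{X}\to\mathcal{X}$ is $T(z)=\beta\zeta z-d(z)$, where $d(z)$ is the unique element of $\mathcal{L}$ with $\beta\zeta z\in\mathcal{X}+d(z)$. Let $\mathcal{A}=\{d(z): z\in\mathcal{X}\}$; the expansion of $z\in\mathcal{X}$ is the word $d_1d_2\dots$ with $d_n=d(T^{n-1}(z))$. For $n\ge 0$ let $T^{-n}(\partial\mathcal{X})=\{z\in\mathcal{X}: T^n(z)\in\partial\mathcal{X}\}$, and let $T^{n}(\partial\mathcal{X})$ be the set of values of $T^n$ at the points of $\partial\mathcal{X}$, where the value at a point $\xi+x\eta_1+y\eta_2$ of $\partial\mathcal{X}\setminus\mathcal{X}$ is the limit, as $\varepsilon\to0^+$, of $T^n$ at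 the point obtained by replacing each of the coordinates $x,y$ that equals $1$ by $1-\varepsilon$. A finite word over $\mathcal{A}$ is admissible if it appears as a block in the expansion of some $z\in\mathcal{X}\setminus\bigcup_{n\in\mathbb{Z}}T^n(\partial\mathcal{X})$. Let $\mathcal{X}_T$ be the set of all $(w_j)\in\mathcal{A}^{\mathbb{Z}}$ such that $w_jw_{j+1}\cdots w_k$ is admissible for all integers $j\le k$. The system $(\mathcal{X},T)$ is called sofic if there is a finite directed graph $G$ with edges labeled by $\mathcal{A}$ such that $\mathcal{X}_T$ is exactly the set of labels of bi-infinite paths in $G$. **Theorem.** Suppose that $\zeta^q=1$ for some integer $q>2$, that $\beta$ is a Pisot number (a real algebraic integer $>1$ all of whose other Galois conjugates have modulus $<1$), and that $\eta_1,\eta_2,\xi\in\mathbb{Q}(\zeta,\beta)$. If $\zeta+\zeta^{-1}\in\mathbb{Q}(\beta)$, then $(\mathcal{X},T)$ is sofic. -/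

import Mathlib

open Filter Topology Set

noncomputable section

/-- A Pisot number: a real algebraic integer greater than `1` all of whose other Galois conjugates
(the complex roots of its minimal polynomial over `ℚ` other than itself) have modulus less than
`1`. -/
def IsPisot (β : ℝ) : Prop :=
  1 < β ∧ IsIntegral ℤ β ∧
    ∀ z : ℂ, Polynomial.aeval z (minpoly ℚ β) = 0 → z ≠ (β : ℂ) → ‖z‖ < 1

/-- The parameters of a rotational beta transformation. -/
structure RotationalBeta where
  /-- the expansion factor -/
  β : ℝ
  /-- the rotation -/
  ζ : ℂ
  /-- the base point of the fundamental domain -/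
  ξ : ℂ
  /-- first generator of the lattice -/
  η₁ : ℂ
  /-- second generator of the lattice -/
  η₂ : ℂ
  one_lt_β : 1 < β
  norm_ζ : ‖ζ‖ = 1
  /-- `ζ` is not real -/
  ζ_im_ne_zero : ζ.im ≠ 0
  /-- `η₁ / η₂` is not real (in particular `η₂ ≠ 0`) -/
  div_im_ne_zero : (η₁ / η₂).im ≠ 0

/-- A finite directed graph (loops and multiple edges allowed) with edges labeled by `A`. -/
structure FiniteLabeledDigraph (A : Type) where
  /-- vertices -/
  V : Type
  /-- edges -/
  E : Type
  finite_V : Finite V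
  finite_E : Finite E
  /-- initial vertex of an edge -/
  source : E → V
  /-- terminal vertex of an edge -/
  target : E → V
  /-- label of an edge -/
  label : E → A

/-- `w` is the label of some bi-infinite path of `G`. -/
def FiniteLabeledDigraph.IsPathLabel {A : Type} (G : FiniteLabeledDigraph A) (w : ℤ → A) : Prop :=
  ∃ e : ℤ → G.E, (∀ i, G.target (e i) = G.source (e (i + 1))) ∧ ∀ i, G.label (e i) = w i

namespace RotationalBeta

variable (S : RotationalBeta)

/-- The point `ξ + x η₁ + y η₂`. -/
def point (x y : ℝ) : ℂ := S.ξ + x * S.η₁ + y * S.η₂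

/-- The half-open parallelogram `𝒳 = {ξ + x η₁ + y η₂ | x, y ∈ [0, 1)}`. -/
def X : Set ℂ := {z | ∃ x ∈ Ico (0 : ℝ) 1, ∃ y ∈ Ico (0 : ℝ) 1, z = S.point x y}

/-- The lattice `ℤ η₁ + ℤ η₂`. -/
def lattice : AddSubgroup ℂ := AddSubgroup.closure {S.η₁, S.η₂}

theorem mem_lattice_iff (d : ℂ) : d ∈ S.lattice ↔ ∃ m n : ℤ, d = m * S.η₁ + n * S.η₂ := by
  simp only [lattice, AddSubgroup.mem_closure_pair, zsmul_eq_mul, eq_comm]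

theorem η₂_ne_zero : S.η₂ ≠ 0 := by
  intro h
  exact S.div_im_ne_zero (by simp [h])

theorem exists_coords (u : ℂ) : ∃ x y : ℝ, u = x * S.η₁ + y * S.η₂ := by
  have h2 := S.η₂_ne_zero
  have hi := S.div_im_ne_zero
  set τ := S.η₁ / S.η₂ with hτ
  refine ⟨(u / S.η₂).im / τ.im, (u / S.η₂).re - (u / S.η₂).im / τ.im * τ.re, ?_⟩
  have key : u / S.η₂ = (((u / S.η₂).im / τ.im : ℝ) : ℂ) * τ
      + (((u / S.η₂).re - (u / S.η₂).im / τ.im * τ.re : ℝ) : ℂ) := by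
    apply Complex.ext
    · rw [Complex.add_re, Complex.re_ofReal_mul, Complex.ofReal_re]; ring
    · rw [Complex.add_im, Complex.im_ofReal_mul, Complex.ofReal_im]; field_simp; ring
  generalize (u / S.η₂).im / τ.im = a at key ⊢
  generalize (u / S.η₂).re - a * τ.re = b at key ⊢
  rw [div_eq_iff h2, add_mul, mul_assoc, hτ, div_mul_cancel₀ _ h2] at key
  exact key

theorem coords_eq_zero {x y : ℝ} (h : (x : ℂ) * S.η₁ + y * S.η₂ = 0) : x = 0 ∧ y = 0 := by
  have h2 := S.η₂_ne_zero
  have hi := S.div_im_ne_zero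
  have h' : (x : ℂ) * (S.η₁ / S.η₂) + y = 0 := by
    have h3 : S.η₁ / S.η₂ * S.η₂ = S.η₁ := div_mul_cancel₀ _ h2
    apply mul_right_cancel₀ h2
    linear_combination h + x * h3
  have him := congrArg Complex.im h'
  rw [Complex.add_im, Complex.im_ofReal_mul, Complex.ofReal_im, Complex.zero_im, add_zero] at him
  have hx : x = 0 := by
    rcases mul_eq_zero.1 him with h | h
    · exact h
    · exact absurd h hi
  refine ⟨hx, ?_⟩
  rw [hx] at h'
  simpa using h'

/-- `ℂ` is the disjoint union of the translates `𝒳 + d`, `d` in the lattice. -/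
theorem existsUnique_digit (u : ℂ) : ∃! d : ℂ, d ∈ S.lattice ∧ u - d ∈ S.X := by
  obtain ⟨x, y, hxy⟩ := S.exists_coords (u - S.ξ)
  refine ⟨⌊x⌋ * S.η₁ + ⌊y⌋ * S.η₂, ⟨(S.mem_lattice_iff _).2 ⟨_, _, rfl⟩, Int.fract x,
    ⟨Int.fract_nonneg x, Int.fract_lt_one x⟩, Int.fract y,
    ⟨Int.fract_nonneg y, Int.fract_lt_one y⟩, ?_⟩, ?_⟩
  · simp only [point, Int.fract, Complex.ofReal_sub, Complex.ofReal_intCast]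
    linear_combination hxy
  · rintro d ⟨hd, s, hs, t, ht, hst⟩
    obtain ⟨m, n, rfl⟩ := (S.mem_lattice_iff _).1 hd
    have h0 : ((x - (m + s) : ℝ) : ℂ) * S.η₁ + ((y - (n + t) : ℝ) : ℂ) * S.η₂ = 0 := by
      simp only [point] at hst
      push_cast
      linear_combination hst - hxy
    obtain ⟨h1, h2⟩ := S.coords_eq_zero h0
    have hm : ⌊x⌋ = m := by
      rw [Int.floor_eq_iff]; constructor <;> linarith [hs.1, hs.2]
    have hn : ⌊y⌋ = n := by
      rw [Int.floor_eq_iff]; constructor <;> linarith [ht.1, ht.2]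
    rw [hm, hn]

/-- The digit `d(z)`: the unique lattice element `d` with `β ζ z ∈ 𝒳 + d`. -/
def digit (z : ℂ) : ℂ := (S.existsUnique_digit (S.β * S.ζ * z)).choose

theorem digit_mem (z : ℂ) : S.digit z ∈ S.lattice :=
  (S.existsUnique_digit (S.β * S.ζ * z)).choose_spec.1.1

/-- The rotational beta transformation `T(z) = β ζ z - d(z)`. The formula makes sense on all of
`ℂ`; only its restriction `𝒳 → 𝒳` is used. -/
def T (z : ℂ) : ℂ := S.β * S.ζ * z - S.digit z

theorem T_mem (z : ℂ) : S.T z ∈ S.X :=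
  (S.existsUnique_digit (S.β * S.ζ * z)).choose_spec.1.2

theorem digit_eq {z d : ℂ} (hd : d ∈ S.lattice) (h : S.β * S.ζ * z - d ∈ S.X) : S.digit z = d :=
  ((S.existsUnique_digit (S.β * S.ζ * z)).choose_spec.2 d ⟨hd, h⟩).symm

/-- The forward image `Tⁿ(∂𝒳)`. The value of `Tⁿ` at a boundary point `ξ + x η₁ + y η₂`,
`x, y ∈ [0, 1]`, is the limit for `ε → 0⁺` of `Tⁿ` at the point of `𝒳` in which each coordinate
equal to `1` is replaced by `1 - ε`: the outer sides of `𝒳` are pushed infinitesimally inside.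
If `x, y < 1`, the point is in `𝒳`, the perturbation is trivial for small `ε`, and the value is
the ordinary one. -/
def boundaryImage (n : ℕ) : Set ℂ :=
  {w | ∃ x ∈ Icc (0 : ℝ) 1, ∃ y ∈ Icc (0 : ℝ) 1, S.point x y ∈ frontier S.X ∧
    Tendsto (fun ε : ℝ => S.T^[n] (S.point (min x (1 - ε)) (min y (1 - ε)))) (𝓝[>] 0) (𝓝 w)}

/-- The inverse image `T⁻ⁿ(∂𝒳)` under `Tⁿ : 𝒳 → 𝒳`. -/
def boundaryPreimage (n : ℕ) : Set ℂ := {z | z ∈ S.X ∧ S.T^[n] z ∈ frontier S.X}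

/-- The set `⋃_{n ∈ ℤ} Tⁿ(∂𝒳)` of forward and backward discontinuities. -/
def discontinuities : Set ℂ := ⋃ n : ℕ, (S.boundaryImage n ∪ S.boundaryPreimage n)

/-- The alphabet `𝒜 = {d(z) | z ∈ 𝒳}`. -/
def alphabet : Set ℂ := S.digit '' S.X

/-- The expansion of `z`, indexed from `0`: `expansion z n = d_{n+1} = d(Tⁿ z)`. -/
def expansion (z : ℂ) (n : ℕ) : ℂ := S.digit (S.T^[n] z)

/-- A finite word over the alphabet is admissible if it appears as a block in the expansion of
some point of `𝒳` off the discontinuities. -/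
def Admissible (w : List S.alphabet) : Prop :=
  ∃ z ∈ S.X \ S.discontinuities, ∃ m : ℕ,
    ∀ i : Fin w.length, S.expansion z (m + i) = (w.get i : ℂ)

/-- The word `w_j w_{j+1} ⋯ w_k` (for `j ≤ k`) of a bi-infinite sequence. -/
def block {A : Type} (w : ℤ → A) (j k : ℤ) : List A :=
  List.ofFn fun i : Fin (k - j + 1).toNat => w (j + (i : ℕ))

/-- The space `𝒳_T` of bi-infinite words all of whose finite blocks are admissible. -/
def shiftSpace : Set (ℤ → S.alphabet) :=
  {w | ∀ j k : ℤ, j ≤ k → S.Admissible (block w j k)}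

/-- The system is sofic: there is a finite directed graph labeled by the alphabet such that the
elements of `𝒳_T` are exactly the labels of its bi-infinite paths. -/
def IsSofic : Prop :=
  ∃ G : FiniteLabeledDigraph S.alphabet, ∀ w : ℤ → S.alphabet,
    w ∈ S.shiftSpace ↔ G.IsPathLabel w

end RotationalBeta

end

noncomputable section

/-! Follow the open sets `step A d` = (βζA − d) ∩ int 𝒳 from A = int 𝒳 along a word. The
discontinuities form a null set and these sets are open, so a word is admissible iff the final set
is nonempty (`admissible_iff`). If only finitely many nonempty sets arise (`finite_states`), they
are the vertices of a finite graph presenting 𝒳_T.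

Each such set is a polygon. A step turns a half-plane Re(az) < c into one with direction aζ⁻¹ and
constant βc − Re(aζ⁻¹d). Since ζ is a root of unity, finitely many directions occur. Constants of
large modulus can be dropped, since those half-planes contain or miss 𝒳. The hypothesis on ζ + ζ⁻¹
puts the numbers Re(aζ⁻¹d) in ℚ(β). The Pisot property then leaves finitely many constants
(`IsPisot.exists_finite_invariant`): denominators stay bounded, the constant itself is bounded, and
its other conjugates are contracted. -/

/-! ### Arithmetic in ℚ(ζ, β) and Pisot finiteness. -/

open IntermediateField in
theorem ofReal_mem_adjoin_iff {β x : ℝ} : (x : ℂ) ∈ ℚ⟮(β : ℂ)⟯ ↔ x ∈ ℚ⟮β⟯ := by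
  let f : ℝ →ₐ[ℚ] ℂ := Complex.ofRealAm.restrictScalars ℚ
  have h : ℚ⟮(β : ℂ)⟯ = ℚ⟮β⟯.map f := by
    rw [adjoin_map, image_singleton]; rfl
  rw [h]
  refine ⟨?_, fun hx => ⟨x, hx, rfl⟩⟩
  rintro ⟨y, hy, hyx⟩
  have : y = x := Complex.ofReal_injective hyx
  exact this ▸ hy

/-- The real and imaginary parts of the elements of `ℚ(ζ, β)`, when `ζ` is a non-real point of the
unit circle with real part in `ℚ(β)`. -/
theorem re_mem_and_im_mul_mem {β : ℝ} {ζ : ℂ} (hζ : ‖ζ‖ = 1) (him : ζ.im ≠ 0)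
    (hre : ζ.re ∈ IntermediateField.adjoin ℚ {β}) {z : ℂ}
    (hz : z ∈ IntermediateField.adjoin ℚ {ζ, (β : ℂ)}) :
    z.re ∈ IntermediateField.adjoin ℚ {β} ∧
      z.im * ζ.im ∈ IntermediateField.adjoin ℚ {β} := by
  set F := IntermediateField.adjoin ℚ {β} with hF
  -- `ζ.im` need not lie in `F`, but its square does; so imaginary parts are controlled only up to
  -- the factor `ζ.im`, and their products lie in `F`.
  have hsq : ζ.im * ζ.im ∈ F := by
    have h1 : ζ.im * ζ.im = 1 - ζ.re * ζ.re := by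
      have := Complex.normSq_eq_norm_sq ζ
      rw [Complex.normSq_apply, hζ] at this
      linarith
    rw [h1]
    exact sub_mem (one_mem _) (mul_mem hre hre)
  have hprod : ∀ {a b : ℝ}, a * ζ.im ∈ F → b * ζ.im ∈ F → a * b ∈ F := by
    intro a b ha hb
    have : a * b = (a * ζ.im) * (b * ζ.im) / (ζ.im * ζ.im) := by field_simp
    rw [this]
    exact div_mem (mul_mem ha hb) hsq
  induction hz using IntermediateField.adjoin_induction with
  | mem x hx =>
    rcases hx with rfl | rfl
    · exact ⟨hre, hsq⟩
    · exact ⟨IntermediateField.mem_adjoin_simple_self ℚ β, by simp⟩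
  | algebraMap x =>
    exact ⟨by simp, by simp⟩
  | add x y _ _ hx hy =>
    refine ⟨add_mem hx.1 hy.1, ?_⟩
    rw [Complex.add_im, add_mul]
    exact add_mem hx.2 hy.2
  | inv x _ hx =>
    have hn : Complex.normSq x ∈ F := by
      rw [Complex.normSq_apply]
      exact add_mem (mul_mem hx.1 hx.1) (hprod hx.2 hx.2)
    rw [Complex.inv_re, Complex.inv_im]
    refine ⟨div_mem hx.1 hn, ?_⟩
    rw [div_mul_eq_mul_div, neg_mul]
    exact div_mem (neg_mem hx.2) hn
  | mul x y _ _ hx hy =>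
    rw [Complex.mul_re, Complex.mul_im]
    refine ⟨sub_mem (mul_mem hx.1 hy.1) (hprod hx.2 hy.2), ?_⟩
    rw [add_mul]
    refine add_mem ?_ ?_
    · rw [mul_assoc]; exact mul_mem hx.1 hy.2
    · rw [mul_right_comm]; exact mul_mem hx.2 hy.1

/-- For a Pisot number `β`, the affine maps `c ↦ β c - d`, `d` in a finite subset of `ℚ(β)`,
generate only finitely many numbers as long as the results stay bounded. -/
theorem IsPisot.exists_finite_invariant {β : ℝ} (hβ : IsPisot β) {D : Set ℝ} (hD : D.Finite)
    (hDβ : ∀ d ∈ D, d ∈ IntermediateField.adjoin ℚ {β}) (R : ℝ) :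
    ∃ C : Set ℝ, C.Finite ∧ D ⊆ C ∧ ∀ c ∈ C, ∀ d ∈ D, |β * c - d| ≤ R → β * c - d ∈ C := by
  obtain ⟨hβ1, hint, hconj⟩ := hβ
  set K := IntermediateField.adjoin ℚ {β} with hK
  have hintQ : IsIntegral ℚ β := hint.tower_top
  have : FiniteDimensional ℚ K := IntermediateField.adjoin.finiteDimensional hintQ
  have : NumberField K := ⟨⟩
  have : Algebra.IsAlgebraic ℤ K :=
    (IsFractionRing.comap_isAlgebraic_iff (A := ℤ) (K := ℚ) (C := K)).2 inferInstance
  let g : K := ⟨β, IntermediateField.mem_adjoin_simple_self ℚ β⟩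
  have hg : IsIntegral ℤ g := by
    rw [← isIntegral_algHom_iff (K.val.restrictScalars ℤ) Subtype.val_injective]
    exact hint
  -- An embedding is determined by the image of β: it is the inclusion, or it sends β to another
  -- conjugate.
  have hemb : ∀ σ : K →+* ℂ, (∀ x : K, σ x = ((x : ℝ) : ℂ)) ∨ ‖σ g‖ < 1 := by
    intro σ
    by_cases h : σ g = (β : ℂ)
    · left
      have h2 : σ.toRatAlgHom = (Complex.ofRealAm.restrictScalars ℚ).comp K.val := by
        apply IntermediateField.adjoin_algHom_ext
        rintro x rfl
        exact h
      intro x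
      exact DFunLike.congr_fun h2 x
    · right
      refine hconj _ ?_ h
      have h2 : minpoly ℚ g = minpoly ℚ β := (minpoly.algebraMap_eq
        (algebraMap K ℝ).injective g).symm
      have h3 := Polynomial.aeval_algHom_apply σ.toRatAlgHom g (minpoly ℚ g)
      rw [minpoly.aeval, map_zero, h2] at h3
      exact h3
  let D' : Set K := Subtype.val ⁻¹' D
  have hD' : D'.Finite := hD.preimage Subtype.val_injective.injOn
  -- A common denominator of `D`; it is never enlarged, because β is an algebraic integer.
  obtain ⟨N, hN0, hN⟩ := Algebra.IsAlgebraic.exists_integral_multiples ℤ hD'.toFinset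
  have hM : ∃ M : ℝ, 0 ≤ M ∧ ∀ σ : K →+* ℂ, ∀ d ∈ D', ‖σ d‖ ≤ M := by
    have hfin : (⋃ σ : K →+* ℂ, (fun d => ‖σ d‖) '' D').Finite :=
      finite_iUnion fun σ => hD'.image _
    obtain ⟨M, hM⟩ := hfin.bddAbove
    exact ⟨max M 0, le_max_right _ _, fun σ d hd =>
      (hM (mem_iUnion.2 ⟨σ, d, hd, rfl⟩)).trans (le_max_left _ _)⟩
  obtain ⟨M, hM0, hM⟩ := hM
  -- M / (1 − ‖σ g‖) is the fixed point of t ↦ ‖σ g‖ t + M, so that bound reproduces itself. At the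
  -- inclusion, `R` bounds the new elements and `M` those of `D`.
  let B : (K →+* ℂ) → ℝ := fun σ => if ‖σ g‖ < 1 then M / (1 - ‖σ g‖) else max R M
  have hMB : ∀ σ, M ≤ B σ := by
    intro σ
    simp only [B]
    split_ifs with h
    · rw [le_div_iff₀ (by linarith)]
      nlinarith [norm_nonneg (σ g)]
    · exact le_max_right _ _
  obtain ⟨B', hB'⟩ := (finite_range B).bddAbove
  let C' : Set K := {x | IsIntegral ℤ (N • x) ∧ ∀ σ : K →+* ℂ, ‖σ x‖ ≤ B σ}
  have hC' : C'.Finite := by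
    have hf := NumberField.Embeddings.finite_of_norm_le K ℂ (‖(N : ℂ)‖ * B')
    refine (hf.preimage (f := fun x : K => N • x) ?_).subset ?_
    · exact fun x _ y _ hxy => smul_right_injective K hN0 hxy
    · refine fun x hx => ⟨hx.1, fun σ => ?_⟩
      rw [map_zsmul, zsmul_eq_mul, norm_mul]
      exact mul_le_mul_of_nonneg_left ((hx.2 σ).trans (hB' ⟨σ, rfl⟩)) (norm_nonneg _)
  refine ⟨Subtype.val '' C', hC'.image _, ?_, ?_⟩
  · intro d hd
    refine ⟨⟨d, hDβ d hd⟩, ⟨hN _ (hD'.mem_toFinset.2 hd), fun σ => (hM σ _ hd).trans (hMB σ)⟩, rfl⟩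
  · rintro _ ⟨c, hc, rfl⟩ d hd hR
    refine ⟨g * c - ⟨d, hDβ d hd⟩, ⟨?_, fun σ => ?_⟩, rfl⟩
    · rw [smul_sub, ← mul_smul_comm]
      exact (hg.mul hc.1).sub (hN _ (hD'.mem_toFinset.2 hd))
    · rcases hemb σ with h | h
      · rw [h]
        have hng : ¬ ‖σ g‖ < 1 := by
          rw [h]
          have := hβ1
          simp only [Complex.norm_real, Real.norm_eq_abs, not_lt, g]
          exact this.le.trans (le_abs_self _)
        simp only [B, if_neg hng, Complex.norm_real, Real.norm_eq_abs]
        exact hR.trans (le_max_left _ _)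
      · have h1 := hc.2 σ
        have h2 := hM σ ⟨d, hDβ d hd⟩ hd
        simp only [B, if_pos h] at h1 ⊢
        rw [map_sub, map_mul]
        calc _ ≤ ‖σ g‖ * ‖σ c‖ + M := by
              refine (norm_sub_le _ _).trans (add_le_add ?_ h2)
              rw [norm_mul]
          _ ≤ ‖σ g‖ * (M / (1 - ‖σ g‖)) + M := by gcongr
          _ = _ := by
              have : 1 - ‖σ g‖ ≠ 0 := by linarith
              field_simp
              ring

/-! ### Linear forms, half-planes and the finiteness of the set of states. -/

namespace RotationalBeta

/-- The coefficient `a` such that `z ↦ Re (a z)` is the real linear form with value `1` at `u` and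
`0` at `v`. -/
def dualForm (u v : ℂ) : ℂ := -Complex.I * (starRingEnd ℂ) v / ((u * (starRingEnd ℂ) v).im : ℝ)

theorem dualForm_mul_re (u v z : ℂ) :
    (dualForm u v * z).re = (z * (starRingEnd ℂ) v).im / (u * (starRingEnd ℂ) v).im := by
  rw [dualForm, div_mul_eq_mul_div, Complex.div_ofReal_re]
  congr 1
  simp
  ring

/-- The value is a quotient of two imaginary parts, and the factor `ζ.im` that each needs to enter
ℚ(β) cancels. Conjugation preserves ℚ(ζ, β) because v̄ = 2 Re v − v. -/
theorem dualForm_mul_re_mem {β : ℝ} {ζ : ℂ} (hζ : ‖ζ‖ = 1) (him : ζ.im ≠ 0)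
    (hre : ζ.re ∈ IntermediateField.adjoin ℚ {β}) {u v z : ℂ}
    (hu : u ∈ IntermediateField.adjoin ℚ {ζ, (β : ℂ)})
    (hv : v ∈ IntermediateField.adjoin ℚ {ζ, (β : ℂ)})
    (hz : z ∈ IntermediateField.adjoin ℚ {ζ, (β : ℂ)}) :
    (dualForm u v * z).re ∈ IntermediateField.adjoin ℚ {β} := by
  have key : ∀ {w : ℂ}, w ∈ IntermediateField.adjoin ℚ {ζ, (β : ℂ)} →
      w.re ∈ IntermediateField.adjoin ℚ {β} ∧
      w.im * ζ.im ∈ IntermediateField.adjoin ℚ {β} := fun hw =>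
    re_mem_and_im_mul_mem hζ him hre hw
  have hle : IntermediateField.adjoin ℚ {(β : ℂ)} ≤ IntermediateField.adjoin ℚ {ζ, (β : ℂ)} :=
    IntermediateField.adjoin.mono _ _ _ (by simp)
  have hvc : (starRingEnd ℂ) v ∈ IntermediateField.adjoin ℚ {ζ, (β : ℂ)} := by
    have h1 : (starRingEnd ℂ) v = (v.re : ℂ) + v.re - v := by
      rw [← Complex.ofReal_add, ← two_mul, ← Complex.add_conj]; ring
    have h2 := hle (ofReal_mem_adjoin_iff.2 (key hv).1)
    rw [h1]
    exact sub_mem (add_mem h2 h2) hv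
  rw [dualForm_mul_re, ← mul_div_mul_right _ _ him]
  exact div_mem (key (mul_mem hz hvc)).2 (key (mul_mem hu hvc)).2

variable (S : RotationalBeta)

/-- The linear form `x η₁ + y η₂ ↦ x`. -/
def form₁ : ℂ := dualForm S.η₁ S.η₂

/-- The linear form `x η₁ + y η₂ ↦ y`. -/
def form₂ : ℂ := dualForm S.η₂ S.η₁

theorem im_mul_conj_ne_zero : (S.η₁ * (starRingEnd ℂ) S.η₂).im ≠ 0 := by
  intro h
  apply S.div_im_ne_zero
  rw [div_eq_mul_inv, Complex.inv_def, ← mul_assoc, Complex.im_mul_ofReal, h, zero_mul]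

theorem im_mul_conj_ne_zero' : (S.η₂ * (starRingEnd ℂ) S.η₁).im ≠ 0 := by
  have h := S.im_mul_conj_ne_zero
  contrapose! h
  simp only [Complex.mul_im, Complex.conj_re, Complex.conj_im] at h ⊢
  linarith

theorem form₁_mul_re (x y : ℝ) : (S.form₁ * (x * S.η₁ + y * S.η₂)).re = x := by
  rw [form₁, dualForm_mul_re, div_eq_iff S.im_mul_conj_ne_zero]
  simp
  ring

theorem form₂_mul_re (x y : ℝ) : (S.form₂ * (x * S.η₁ + y * S.η₂)).re = y := by
  rw [form₂, dualForm_mul_re, div_eq_iff S.im_mul_conj_ne_zero']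
  simp
  ring

theorem re_mul_combo (u : ℂ) :
    ((S.form₁ * u).re : ℂ) * S.η₁ + ((S.form₂ * u).re : ℂ) * S.η₂ = u := by
  obtain ⟨x, y, rfl⟩ := S.exists_coords u
  rw [form₁_mul_re, form₂_mul_re]

/-- The coordinates with respect to the frame `(ξ; η₁, η₂)`. -/
def coords : ℂ ≃ₜ ℝ × ℝ where
  toFun z := ((S.form₁ * (z - S.ξ)).re, (S.form₂ * (z - S.ξ)).re)
  invFun p := S.point p.1 p.2
  left_inv z := by
    have := S.re_mul_combo (z - S.ξ)
    simp only [point]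
    linear_combination this
  right_inv p := by
    have : S.point p.1 p.2 - S.ξ = p.1 * S.η₁ + p.2 * S.η₂ := by simp only [point]; ring
    simp only [this, form₁_mul_re, form₂_mul_re]
  continuous_toFun := by fun_prop
  continuous_invFun := by unfold point; fun_prop

theorem X_eq_preimage : S.X = S.coords ⁻¹' (Ico 0 1 ×ˢ Ico 0 1) := by
  ext z
  constructor
  · rintro ⟨x, hx, y, hy, rfl⟩
    have : S.coords (S.point x y) = (x, y) := S.coords.right_inv (x, y)
    rw [mem_preimage, this]
    exact ⟨hx, hy⟩
  · rintro ⟨h1, h2⟩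
    exact ⟨_, h1, _, h2, (S.coords.left_inv z).symm⟩

theorem interior_X : interior S.X = S.coords ⁻¹' (Ioo 0 1 ×ˢ Ioo 0 1) := by
  rw [X_eq_preimage, ← S.coords.preimage_interior, interior_prod_eq, interior_Ico]

theorem convex_X : Convex ℝ S.X := by
  rw [X_eq_preimage]
  have h : ∀ a : ℂ, ∀ z w : ℂ, ∀ s t : ℝ, s + t = 1 →
      (a * (s • z + t • w - S.ξ)).re = s * (a * (z - S.ξ)).re + t * (a * (w - S.ξ)).re := by
    intro a z w s t hst
    have : a * (s • z + t • w - S.ξ) = s * (a * (z - S.ξ)) + t * (a * (w - S.ξ)) := by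
      have hst' : (s : ℂ) + t = 1 := by exact_mod_cast hst
      rw [Complex.real_smul, Complex.real_smul]
      linear_combination a * S.ξ * hst'
    rw [this, Complex.add_re, Complex.re_ofReal_mul, Complex.re_ofReal_mul]
  intro z hz w hw s t hs ht hst
  have hc : S.coords (s • z + t • w) = s • S.coords z + t • S.coords w :=
    Prod.ext (h _ z w s t hst) (h _ z w s t hst)
  rw [mem_preimage, hc]
  exact ((convex_Ico 0 1).prod (convex_Ico 0 1)) hz hw hs ht hst

theorem norm_le_of_mem_X {z : ℂ} (hz : z ∈ S.X) : ‖z‖ ≤ ‖S.ξ‖ + ‖S.η₁‖ + ‖S.η₂‖ := by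
  obtain ⟨x, hx, y, hy, rfl⟩ := hz
  have h : ∀ x ∈ Ico (0 : ℝ) 1, ∀ w : ℂ, ‖(x : ℂ) * w‖ ≤ ‖w‖ := by
    intro x hx w
    rw [norm_mul, Complex.norm_real, Real.norm_of_nonneg hx.1]
    exact mul_le_of_le_one_left (norm_nonneg _) hx.2.le
  exact (norm_add_le _ _).trans (add_le_add ((norm_add_le _ _).trans
    (add_le_add le_rfl (h x hx _))) (h y hy _))

/-- Digits are bounded, being differences of bounded quantities, so their integer coordinates in the
lattice are bounded. -/
theorem finite_alphabet : S.alphabet.Finite := by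
  set r := ‖S.ξ‖ + ‖S.η₁‖ + ‖S.η₂‖
  set M : ℤ := ⌈(‖S.form₁‖ + ‖S.form₂‖) * (S.β * r + r)⌉ with hM
  refine ((finite_Icc (-M) M).image2 (fun m n : ℤ => (m : ℂ) * S.η₁ + n * S.η₂)
    (finite_Icc (-M) M)).subset ?_
  rintro _ ⟨z, hz, rfl⟩
  have hβ : 0 < S.β := zero_lt_one.trans S.one_lt_β
  have hd : ‖S.digit z‖ ≤ S.β * r + r := by
    have h1 : S.digit z = S.β * S.ζ * z - S.T z := by simp [T]
    rw [h1]
    refine (norm_sub_le _ _).trans (add_le_add ?_ (S.norm_le_of_mem_X (S.T_mem z)))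
    rw [norm_mul, norm_mul, S.norm_ζ, mul_one, Complex.norm_real, Real.norm_of_nonneg hβ.le]
    exact mul_le_mul_of_nonneg_left (S.norm_le_of_mem_X hz) hβ.le
  have hr : 0 ≤ S.β * r + r := (norm_nonneg _).trans hd
  have hbound : ∀ a : ℂ, ‖a‖ ≤ ‖S.form₁‖ + ‖S.form₂‖ → ∀ m : ℤ, (a * S.digit z).re = m →
      m ∈ Icc (-M) M := by
    intro a ha m hm
    have : |(m : ℝ)| ≤ M := by
      rw [← hm]
      refine (Complex.abs_re_le_norm _).trans ?_
      rw [norm_mul]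
      exact (mul_le_mul ha hd (norm_nonneg _) (by positivity)).trans (Int.le_ceil _)
    rw [← abs_le.trans mem_Icc.symm]
    exact_mod_cast this
  obtain ⟨m, n, hmn⟩ := (S.mem_lattice_iff _).1 (S.digit_mem z)
  refine ⟨m, hbound S.form₁ (by simp) m ?_, n, hbound S.form₂ (by simp) n ?_, hmn.symm⟩
  · rw [hmn]; exact_mod_cast S.form₁_mul_re m n
  · rw [hmn]; exact_mod_cast S.form₂_mul_re m n

/-- The intersection of the open half-planes `Re (a z) < c`, `(a, c) ∈ H`. -/
def openPolygon (H : Set (ℂ × ℝ)) : Set ℂ := {z | ∀ h ∈ H, (h.1 * z).re < h.2}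

/-- The directions `a` of the half-planes `Re (a z) < c` bounded by the sides of `𝒳`. -/
def sideForms : Set ℂ := {S.form₁, -S.form₁, S.form₂, -S.form₂}

/-- The four half-planes that cut out the interior of `𝒳`. -/
def sides : Set (ℂ × ℝ) :=
  {(S.form₁, (S.form₁ * S.ξ).re + 1), (-S.form₁, -(S.form₁ * S.ξ).re),
    (S.form₂, (S.form₂ * S.ξ).re + 1), (-S.form₂, -(S.form₂ * S.ξ).re)}

theorem interior_X_eq_openPolygon : interior S.X = openPolygon S.sides := by
  rw [interior_X]
  ext z
  have h : z ∈ S.coords ⁻¹' (Ioo 0 1 ×ˢ Ioo 0 1) ↔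
      (0 < (S.form₁ * (z - S.ξ)).re ∧ (S.form₁ * (z - S.ξ)).re < 1) ∧
      (0 < (S.form₂ * (z - S.ξ)).re ∧ (S.form₂ * (z - S.ξ)).re < 1) := Iff.rfl
  rw [h]
  simp only [mul_sub, Complex.sub_re]
  simp only [openPolygon, sides, mem_ofPred_eq, mem_insert_iff, mem_singleton_iff,
    forall_eq_or_imp, forall_eq, neg_mul, Complex.neg_re]
  constructor
  · rintro ⟨⟨h1, h2⟩, h3, h4⟩
    exact ⟨by linarith, by linarith, by linarith, by linarith⟩
  · rintro ⟨h1, h2, h3, h4⟩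
    exact ⟨⟨by linarith, by linarith⟩, by linarith, by linarith⟩

/-- One step of the subset automaton on open subsets of `𝒳`: the interior points of `𝒳` that are
of the form `β ζ z - d` with `z ∈ A`. -/
def step (A : Set ℂ) (d : S.alphabet) : Set ℂ :=
  {u | u ∈ interior S.X ∧ (u + d) / (S.β * S.ζ) ∈ A}

theorem ζ_ne_zero : S.ζ ≠ 0 := by
  intro h
  exact S.ζ_im_ne_zero (by simp [h])

theorem mul_ne_zero' : (S.β : ℂ) * S.ζ ≠ 0 :=
  mul_ne_zero (by exact_mod_cast (zero_lt_one.trans S.one_lt_β).ne') S.ζ_ne_zero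

/-- The open half-plane `Re (a z) < c` is mapped by `z ↦ β ζ z - d` to a half-plane with direction
`a ζ⁻¹`. -/
theorem mul_div_re_lt_iff (a u d : ℂ) (c : ℝ) :
    (a * ((u + d) / (S.β * S.ζ))).re < c ↔
      (a * S.ζ⁻¹ * u).re < S.β * c - (a * S.ζ⁻¹ * d).re := by
  have hβ : 0 < S.β := zero_lt_one.trans S.one_lt_β
  have h : a * ((u + d) / (S.β * S.ζ)) = (a * S.ζ⁻¹ * u + a * S.ζ⁻¹ * d) / (S.β : ℝ) := by
    have := S.ζ_ne_zero
    have : (S.β : ℂ) ≠ 0 := by exact_mod_cast hβ.ne'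
    field_simp
  rw [h, Complex.div_ofReal_re, Complex.add_re, div_lt_iff₀ hβ]
  constructor <;> intro h <;> linarith

/-- The states of the subset automaton. -/
def states : Set (Set ℂ) :=
  {A | A.Nonempty ∧ ∃ w : List S.alphabet, A = w.foldl S.step (interior S.X)}

/-- The states are polygons with sides in a finite family of lines, provided there is a finite
family of half-planes containing the sides of `𝒳` and stable under the transformation up to
half-planes that contain or miss `𝒳`. -/
theorem finite_states_of_halfPlanes {H : Set (ℂ × ℝ)} (hH : H.Finite) (hsides : S.sides ⊆ H)
    {R : ℝ} (hR : ∀ h ∈ H, ∀ z ∈ S.X, |(h.1 * S.ζ⁻¹ * z).re| ≤ R)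
    (hstep : ∀ h ∈ H, ∀ d ∈ S.alphabet, |S.β * h.2 - (h.1 * S.ζ⁻¹ * d).re| ≤ R →
      (h.1 * S.ζ⁻¹, S.β * h.2 - (h.1 * S.ζ⁻¹ * d).re) ∈ H) :
    S.states.Finite := by
  refine ((hH.finite_subsets).image openPolygon).subset ?_
  rintro A ⟨hA, w, rfl⟩
  induction w using List.reverseRecOn with
  | nil => exact ⟨S.sides, hsides, S.interior_X_eq_openPolygon.symm⟩
  | append_singleton w d ih =>
    rw [List.foldl_append, List.foldl_cons, List.foldl_nil] at hA ⊢
    set A := w.foldl S.step (interior S.X)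
    -- A point of the new state has its preimage in the old one, so the old state is nonempty too.
    obtain ⟨H₀, hH₀, hpoly⟩ := ih (hA.imp' (fun u => (u + d) / (S.β * S.ζ)) fun u hu => hu.2)
    -- The canonical choice: all half-planes of `H` that contain the new state.
    refine ⟨{h ∈ H | ∀ u ∈ S.step A d, (h.1 * u).re < h.2}, fun h hh => hh.1, ?_⟩
    apply Subset.antisymm
    · intro u hu
      have huX : u ∈ interior S.X := by
        obtain ⟨v, hv⟩ := hA
        rw [interior_X_eq_openPolygon]
        refine fun h hh => hu h ⟨hsides hh, fun v hv => ?_⟩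
        have := hv.1
        rw [interior_X_eq_openPolygon] at this
        exact this h hh
      refine ⟨huX, ?_⟩
      rw [← hpoly]
      intro h hh
      rw [mul_div_re_lt_iff]
      have hRu := abs_le.1 (hR h (hH₀ hh) u (interior_subset huX))
      -- Above `R` the half-plane contains 𝒳 and imposes nothing. Below −`R` it would miss 𝒳, which
      -- the nonempty state rules out.
      by_cases hc : S.β * h.2 - (h.1 * S.ζ⁻¹ * d).re ≤ R
      · have hmem : ∀ v ∈ S.step A d,
            (h.1 * S.ζ⁻¹ * v).re < S.β * h.2 - (h.1 * S.ζ⁻¹ * d).re := by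
          intro v hv
          rw [← mul_div_re_lt_iff]
          exact (hpoly ▸ hv.2 : _ ∈ openPolygon H₀) h hh
        refine hu (_, _) ⟨hstep h (hH₀ hh) d d.2 (abs_le.2 ⟨?_, hc⟩), hmem⟩
        obtain ⟨v, hv⟩ := hA
        have hRv := abs_le.1 (hR h (hH₀ hh) v (interior_subset hv.1))
        linarith [hmem v hv]
      · linarith
    · exact fun u hu h hh => hh.2 u hu

/-- The family of half-planes is a product: directions are side forms times powers of ζ⁻¹, and
constants come from the Pisot lemma. -/
theorem finite_states (q : ℕ) (hq : 0 < q) (hζ : S.ζ ^ q = 1) (hβ : IsPisot S.β)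
    (hη₁ : S.η₁ ∈ IntermediateField.adjoin ℚ {S.ζ, (S.β : ℂ)})
    (hη₂ : S.η₂ ∈ IntermediateField.adjoin ℚ {S.ζ, (S.β : ℂ)})
    (hξ : S.ξ ∈ IntermediateField.adjoin ℚ {S.ζ, (S.β : ℂ)})
    (hre : S.ζ.re ∈ IntermediateField.adjoin ℚ {S.β}) : S.states.Finite := by
  have hpow : (range fun k : ℕ => S.ζ⁻¹ ^ k).Finite := by
    refine ((finite_Iio q).image fun k : ℕ => S.ζ⁻¹ ^ k).subset ?_
    rintro _ ⟨k, rfl⟩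
    refine ⟨k % q, Nat.mod_lt _ hq, ?_⟩
    exact (pow_eq_pow_mod k (by rw [inv_pow, hζ, inv_one])).symm
  set Φ : Set ℂ := image2 (fun a p => a * p) S.sideForms (range fun k : ℕ => S.ζ⁻¹ ^ k) with hΦ
  have hΦfin : Φ.Finite := (by simp [sideForms] : S.sideForms.Finite).image2 _ hpow
  have hΦζ : ∀ a ∈ Φ, a * S.ζ⁻¹ ∈ Φ := by
    rintro _ ⟨a, ha, _, ⟨k, rfl⟩, rfl⟩
    exact ⟨a, ha, _, ⟨k + 1, rfl⟩, by ring⟩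
  have hζL : S.ζ⁻¹ ∈ IntermediateField.adjoin ℚ {S.ζ, (S.β : ℂ)} :=
    inv_mem (IntermediateField.subset_adjoin _ _ (by simp))
  have hform : ∀ a ∈ S.sideForms, ∀ z ∈ IntermediateField.adjoin ℚ {S.ζ, (S.β : ℂ)},
      (a * z).re ∈ IntermediateField.adjoin ℚ {S.β} := by
    intro a ha z hz
    have h1 := dualForm_mul_re_mem S.norm_ζ S.ζ_im_ne_zero hre hη₁ hη₂ hz
    have h2 := dualForm_mul_re_mem S.norm_ζ S.ζ_im_ne_zero hre hη₂ hη₁ hz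
    rcases ha with rfl | rfl | rfl | rfl
    · exact h1
    · rw [neg_mul, Complex.neg_re]; exact neg_mem h1
    · exact h2
    · rw [neg_mul, Complex.neg_re]; exact neg_mem h2
  have hΦL : ∀ a ∈ Φ, ∀ z ∈ IntermediateField.adjoin ℚ {S.ζ, (S.β : ℂ)},
      (a * z).re ∈ IntermediateField.adjoin ℚ {S.β} := by
    rintro _ ⟨a, ha, _, ⟨k, rfl⟩, rfl⟩ z hz
    simp only [mul_assoc]
    exact hform a ha _ (mul_mem (pow_mem hζL k) hz)
  have hL : ∀ d ∈ S.alphabet, d ∈ IntermediateField.adjoin ℚ {S.ζ, (S.β : ℂ)} := by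
    rintro _ ⟨z, -, rfl⟩
    obtain ⟨m, n, h⟩ := (S.mem_lattice_iff _).1 (S.digit_mem z)
    rw [h]
    exact add_mem (mul_mem (intCast_mem _ _) hη₁) (mul_mem (intCast_mem _ _) hη₂)
  -- The Pisot lemma uses one set both as seeds and as translations, so the initial side constants
  -- are joined to the shifts Re(ad).
  set D : Set ℝ := image2 (fun a d => (a * d).re) Φ S.alphabet ∪ Prod.snd '' S.sides with hD
  have hDfin : D.Finite := (hΦfin.image2 _ S.finite_alphabet).union
    ((by simp [sides] : S.sides.Finite).image _)
  have hDmem : ∀ d ∈ D, d ∈ IntermediateField.adjoin ℚ {S.β} := by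
    rintro d (⟨a, ha, d, hd, rfl⟩ | ⟨h, hh, rfl⟩)
    · exact hΦL a ha d (hL d hd)
    · have h1 := hform S.form₁ (by simp [sideForms]) _ hξ
      have h2 := hform S.form₂ (by simp [sideForms]) _ hξ
      rcases hh with rfl | rfl | rfl | rfl
      · exact add_mem h1 (one_mem _)
      · exact neg_mem h1
      · exact add_mem h2 (one_mem _)
      · exact neg_mem h2
  obtain ⟨M, hM⟩ := (hΦfin.image norm).bddAbove
  set R := M * (‖S.ξ‖ + ‖S.η₁‖ + ‖S.η₂‖)
  obtain ⟨C, hC, hDC, hCstep⟩ := hβ.exists_finite_invariant hDfin hDmem R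
  refine S.finite_states_of_halfPlanes (H := Φ ×ˢ C) (hΦfin.prod hC) ?_ (R := R) ?_ ?_
  · intro h hh
    refine ⟨⟨h.1, ?_, 1, ⟨0, pow_zero _⟩, mul_one _⟩, hDC (Or.inr ⟨h, hh, rfl⟩)⟩
    rcases hh with rfl | rfl | rfl | rfl <;> simp [sideForms]
  · rintro h ⟨hh, -⟩ z hz
    refine (Complex.abs_re_le_norm _).trans ?_
    have ha := hM ⟨_, hΦζ _ hh, rfl⟩
    rw [norm_mul]
    exact mul_le_mul ha (S.norm_le_of_mem_X hz) (norm_nonneg _) ((norm_nonneg _).trans ha)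
  · rintro h ⟨hh, hc⟩ d hd hR
    exact ⟨hΦζ _ hh, hCstep _ hc _ (Or.inl ⟨_, hΦζ _ hh, d, hd, rfl⟩) hR⟩

end RotationalBeta

/-! ### Null discontinuities and admissibility. -/

namespace RotationalBeta

variable (S : RotationalBeta)

/-- The translation parts of `Tⁿ` on `𝒳`. -/
def translations (n : ℕ) : Set ℂ :=
  (fun z => (S.β * S.ζ) ^ n * z - S.T^[n] z) '' S.X

theorem iterate_mem_X {z : ℂ} (hz : z ∈ S.X) : ∀ n, S.T^[n] z ∈ S.X
  | 0 => hz
  | n + 1 => by rw [Function.iterate_succ_apply']; exact S.T_mem _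

/-- One more application of T multiplies the translation part by βζ and adds a digit. Hence forward
and backward images of ∂𝒳 are covered by finitely many affine copies of ∂𝒳. -/
theorem finite_translations (n : ℕ) : (S.translations n).Finite := by
  induction n with
  | zero =>
    refine (finite_singleton 0).subset ?_
    rintro _ ⟨z, -, rfl⟩
    simp
  | succ n ih =>
    refine (ih.image2 (fun l d => S.β * S.ζ * l + d) S.finite_alphabet).subset ?_
    rintro _ ⟨z, hz, rfl⟩
    refine ⟨_, ⟨z, hz, rfl⟩, _, ⟨S.T^[n] z, S.iterate_mem_X hz n, rfl⟩, ?_⟩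
    simp only [Function.iterate_succ_apply', T]
    ring

open MeasureTheory

/-- The boundary of a convex set is null, and differentiable maps of the plane preserve null sets.
-/
theorem volume_image_frontier (a b : ℂ) :
    volume ((fun z => a * z + b) '' frontier S.X) = 0 :=
  addHaar_image_eq_zero_of_differentiableOn_of_addHaar_eq_zero volume
    (f := fun z : ℂ => a * z + b)
    (by fun_prop) (S.convex_X.addHaar_frontier volume)

theorem _root_.tendsto_min_one_sub {x : ℝ} (hx : x ≤ 1) :
    Tendsto (fun ε : ℝ => min x (1 - ε)) (𝓝[>] 0) (𝓝 x) := by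
  have hc : Continuous fun ε : ℝ => min x (1 - ε) := by fun_prop
  have h := hc.tendsto 0
  rw [sub_zero, min_eq_left hx] at h
  exact h.mono_left nhdsWithin_le_nhds

/-- The perturbed points lie in 𝒳, so their translation parts lie in a finite, hence closed, set,
which also contains the limit. -/
theorem exists_translation_of_mem_boundaryImage {n : ℕ} {w : ℂ} (hw : w ∈ S.boundaryImage n) :
    ∃ p ∈ frontier S.X, (S.β * S.ζ) ^ n * p - w ∈ S.translations n := by
  obtain ⟨x, hx, y, hy, hfr, hlim⟩ := hw
  have hX : ∀ ε ∈ Ioo (0 : ℝ) 1, S.point (min x (1 - ε)) (min y (1 - ε)) ∈ S.X := by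
    intro ε hε
    have hmin : ∀ x ∈ Icc (0 : ℝ) 1, min x (1 - ε) ∈ Ico (0 : ℝ) 1 := fun x hx =>
      ⟨le_min hx.1 (sub_nonneg.2 hε.2.le), (min_le_right _ _).trans_lt (sub_lt_self _ hε.1)⟩
    exact ⟨_, hmin x hx, _, hmin y hy, rfl⟩
  have hcoe : ∀ x ≤ (1 : ℝ), Tendsto (fun ε : ℝ => ((min x (1 - ε) : ℝ) : ℂ)) (𝓝[>] 0) (𝓝 x) :=
    fun x hx => (Complex.continuous_ofReal.tendsto x).comp (tendsto_min_one_sub hx)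
  have hp : Tendsto (fun ε : ℝ => S.point (min x (1 - ε)) (min y (1 - ε))) (𝓝[>] 0)
      (𝓝 (S.point x y)) :=
    (((hcoe x hx.2).mul_const S.η₁).const_add S.ξ).add ((hcoe y hy.2).mul_const S.η₂)
  refine ⟨S.point x y, hfr, (S.finite_translations n).isClosed.mem_of_tendsto
    ((hp.const_mul ((S.β * S.ζ) ^ n)).sub hlim) ?_⟩
  exact eventually_of_mem (Ioo_mem_nhdsGT (zero_lt_one' ℝ)) fun ε hε =>
    mem_image_of_mem _ (hX ε hε)

theorem volume_boundaryImage (n : ℕ) : volume (S.boundaryImage n) = 0 := by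
  refine measure_mono_null (t := ⋃ l ∈ S.translations n,
    (fun z => (S.β * S.ζ) ^ n * z + -l) '' frontier S.X) (fun w hw => ?_)
    ((measure_biUnion_null_iff (S.finite_translations n).countable).2
      fun l _ => S.volume_image_frontier _ _)
  obtain ⟨p, hp, hl⟩ := S.exists_translation_of_mem_boundaryImage hw
  refine mem_biUnion hl ⟨p, hp, ?_⟩
  ring

theorem volume_boundaryPreimage (n : ℕ) : volume (S.boundaryPreimage n) = 0 := by
  refine measure_mono_null ?_ ((measure_biUnion_null_iff (S.finite_translations n).countable).2
    fun l _ => S.volume_image_frontier ((S.β * S.ζ) ^ n)⁻¹ (((S.β * S.ζ) ^ n)⁻¹ * l))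
  rintro z ⟨hz, hfr⟩
  have h0 := pow_ne_zero n S.mul_ne_zero'
  refine mem_biUnion ⟨z, hz, rfl⟩ ⟨_, hfr, ?_⟩
  simp only
  field_simp
  ring

theorem volume_discontinuities : volume S.discontinuities = 0 :=
  measure_iUnion_null fun n =>
    measure_union_null (S.volume_boundaryImage n) (S.volume_boundaryPreimage n)

theorem isOpen_step {A : Set ℂ} (hA : IsOpen A) (d : S.alphabet) : IsOpen (S.step A d) :=
  isOpen_interior.inter (hA.preimage (by fun_prop))

theorem step_subset (A : Set ℂ) (d : S.alphabet) : S.step A d ⊆ interior S.X := fun _ hu => hu.1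

theorem foldl_step_mono {A B : Set ℂ} (h : A ⊆ B) (w : List S.alphabet) :
    w.foldl S.step A ⊆ w.foldl S.step B := by
  induction w generalizing A B with
  | nil => exact h
  | cons d w ih => exact ih fun u hu => ⟨hu.1, h hu.2⟩

/-- If the subset automaton does not die on `w` when started at the open set `A`, then the points
of some nonempty open subset of `A` have an expansion starting with `w`. -/
theorem exists_open_expansion {A : Set ℂ} (hA : IsOpen A) {w : List S.alphabet}
    (hw : (w.foldl S.step A).Nonempty) :
    ∃ O ⊆ A, IsOpen O ∧ O.Nonempty ∧
      ∀ z ∈ O, ∀ i : Fin w.length, S.expansion z i = w.get i := by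
  induction w generalizing A with
  | nil => exact ⟨A, Subset.rfl, hA, hw, fun _ _ i => i.elim0⟩
  | cons d w ih =>
    obtain ⟨O, hOA, hO, ⟨u, hu⟩, hexp⟩ := ih (S.isOpen_step hA d) hw
    have h0 := S.mul_ne_zero'
    have hd : (d : ℂ) ∈ S.lattice := by
      obtain ⟨z, -, hz⟩ := d.2
      exact hz ▸ S.digit_mem z
    refine ⟨A ∩ (fun z => S.β * S.ζ * z - d) ⁻¹' O, inter_subset_left,
      hA.inter (hO.preimage (by fun_prop)), ⟨(u + d) / (S.β * S.ζ), (hOA hu).2, ?_⟩, ?_⟩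
    · have : S.β * S.ζ * ((u + d) / (S.β * S.ζ)) - d = u := by
        rw [mul_div_cancel₀ _ h0, add_sub_cancel_right]
      rw [mem_preimage, this]
      exact hu
    · rintro z ⟨-, hz⟩ i
      have hdig : S.digit z = d := S.digit_eq hd (interior_subset (hOA hz).1)
      refine Fin.cases ?_ (fun i => ?_) i
      · exact hdig
      · have hT : S.T z ∈ O := by rw [T, hdig]; exact hz
        have := hexp (S.T z) hT i
        simpa [expansion] using this

theorem iterate_mem_interior {z : ℂ} (hz : z ∈ S.X \ S.discontinuities) (n : ℕ) :
    S.T^[n] z ∈ interior S.X := by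
  rw [← self_sdiff_frontier]
  exact ⟨S.iterate_mem_X hz.1 n, fun h => hz.2 (mem_iUnion.2 ⟨n, Or.inr ⟨hz.1, h⟩⟩)⟩

theorem iterate_mem_foldl_step {z : ℂ} (hz : ∀ n, S.T^[n] z ∈ interior S.X) {A : Set ℂ}
    {w : List S.alphabet} {m : ℕ} (hA : S.T^[m] z ∈ A)
    (hw : ∀ i : Fin w.length, S.expansion z (m + i) = w.get i) :
    S.T^[m + w.length] z ∈ w.foldl S.step A := by
  induction w generalizing A m with
  | nil => exact hA
  | cons d w ih =>
    rw [List.length_cons, add_comm w.length, ← add_assoc]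
    refine ih ⟨hz _, ?_⟩ fun i => ?_
    · have h1 : S.digit (S.T^[m] z) = d := hw 0
      rw [Function.iterate_succ_apply', T, h1, sub_add_cancel, mul_div_cancel_left₀ _ S.mul_ne_zero']
      exact hA
    · have := hw i.succ
      rw [Fin.val_succ, ← add_assoc, add_right_comm] at this
      exact this

/-- An orbit off the discontinuities stays in int 𝒳 and so survives every step. Conversely, a
nonempty open set of points with the right expansion has positive measure and cannot consist of
discontinuities. -/
theorem admissible_iff (w : List S.alphabet) :
    S.Admissible w ↔ (w.foldl S.step (interior S.X)).Nonempty := by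
  constructor
  · rintro ⟨z, hz, m, hw⟩
    have h := S.iterate_mem_interior hz
    exact ⟨_, S.iterate_mem_foldl_step h (h m) hw⟩
  · intro hw
    obtain ⟨O, hOX, hO, hne, hexp⟩ := S.exists_open_expansion isOpen_interior hw
    have hpos : volume (O \ S.discontinuities) ≠ 0 := by
      rw [measure_sdiff_null S.volume_discontinuities]
      exact (hO.measure_pos volume hne).ne'
    obtain ⟨z, hz, hzd⟩ := nonempty_of_measure_ne_zero hpos
    exact ⟨z, ⟨interior_subset (hOX hz), hzd⟩, 0, by simpa using hexp z hz⟩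

end RotationalBeta

/-- The word `w_j w_{j+1} ⋯ w_{j+n-1}`. -/
def wordAt {A : Type} (w : ℤ → A) (j : ℤ) (n : ℕ) : List A :=
  List.ofFn fun i : Fin n => w (j + (i : ℕ))

theorem wordAt_succ {A : Type} (w : ℤ → A) (j : ℤ) (n : ℕ) :
    wordAt w j (n + 1) = w j :: wordAt w (j + 1) n := by
  rw [wordAt, List.ofFn_succ, wordAt]
  simp [add_assoc, add_comm (1 : ℤ)]

theorem wordAt_succ' {A : Type} (w : ℤ → A) (j : ℤ) (n : ℕ) :
    wordAt w j (n + 1) = wordAt w j n ++ [w (j + n)] := by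
  rw [wordAt, List.ofFn_succ', wordAt, List.concat_eq_append]
  simp

/-! ### Bi-infinite words and paths in the graph of states. -/

namespace RotationalBeta

variable (S : RotationalBeta)

theorem mem_shiftSpace_iff (w : ℤ → S.alphabet) :
    w ∈ S.shiftSpace ↔ ∀ j n, ((wordAt w j n).foldl S.step (interior S.X)).Nonempty := by
  have h : ∀ j (n : ℕ), block w j (j + n) = wordAt w j (n + 1) := by
    intro j n
    have : (j + (n : ℤ) - j + 1).toNat = n + 1 := by omega
    rw [block, this, wordAt]
  constructor
  · intro hw j n
    have := (S.admissible_iff _).1 (hw j (j + n) (by omega))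
    rw [h, wordAt_succ', List.foldl_append] at this
    -- A block has at least one letter, so the last letter is dropped again to cover the empty word.
    exact this.imp' (fun u => (u + w (j + n)) / (S.β * S.ζ)) fun u hu => hu.2
  · intro hw j k hjk
    rw [admissible_iff]
    obtain ⟨n, rfl⟩ := Int.le.dest hjk
    rw [h]
    exact hw _ _

/-- The graph of the subset automaton. -/
def stepGraph (h : S.states.Finite) : FiniteLabeledDigraph S.alphabet where
  V := S.states
  E := {e : S.states × S.alphabet // (S.step e.1 e.2).Nonempty}
  finite_V := h
  finite_E := by
    have := h.to_subtype
    have := S.finite_alphabet.to_subtype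
    infer_instance
  source e := e.1.1
  target e := ⟨S.step e.1.1 e.1.2, e.2, by
    obtain ⟨w, hw⟩ := e.1.1.2.2
    exact ⟨w ++ [e.1.2], by rw [List.foldl_append, ← hw]; rfl⟩⟩
  label e := e.1.2

/-- A path starts reading at a state inside int 𝒳; by monotonicity, reading the same word from int 𝒳
gives a larger set, hence a nonempty one. -/
theorem mem_shiftSpace_of_isPathLabel {h : S.states.Finite} {w : ℤ → S.alphabet}
    (hw : (S.stepGraph h).IsPathLabel w) : w ∈ S.shiftSpace := by
  obtain ⟨e, he, hl⟩ := hw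
  rw [mem_shiftSpace_iff]
  intro j n
  let A : ℤ → Set ℂ := fun i => ((e i).1.1 : Set ℂ)
  have hA : ∀ i, S.step (A i) (w i) = A (i + 1) := by
    intro i
    rw [← hl i]
    exact congrArg Subtype.val (he i)
  have hfold : (wordAt w j n).foldl S.step (A j) = A (j + n) := by
    induction n with
    | zero => simp [wordAt]
    | succ n ih =>
      rw [wordAt_succ', List.foldl_append, ih, Nat.cast_succ, ← add_assoc]
      exact hA _
  have hsub : A j ⊆ interior S.X := by
    have := S.step_subset (A (j - 1)) (w (j - 1))
    rwa [hA, sub_add_cancel] at this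
  have hne : (A (j + n)).Nonempty := (e (j + n)).1.1.2.1
  exact (hfold ▸ hne).mono (S.foldl_step_mono hsub _)

/-- Let `G i n` be the state reached just before position `i` by reading the `n` preceding letters.
It decreases in `n` and takes finitely many values, so it stabilises; the stable states are the
vertices of the path. -/
theorem isPathLabel_of_mem_shiftSpace (h : S.states.Finite) {w : ℤ → S.alphabet}
    (hw : w ∈ S.shiftSpace) : (S.stepGraph h).IsPathLabel w := by
  rw [mem_shiftSpace_iff] at hw
  let G : ℤ → ℕ → Set ℂ := fun i n => (wordAt w (i - n) n).foldl S.step (interior S.X)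
  have hG : ∀ i n, G i n ∈ S.states := fun i n => ⟨hw _ _, _, rfl⟩
  have hanti : ∀ i, Antitone (G i) := by
    refine fun i => antitone_nat_of_succ_le fun n => ?_
    simp only [G]
    rw [wordAt_succ, List.foldl_cons, Nat.cast_succ, sub_add_eq_sub_sub, sub_add_cancel]
    exact S.foldl_step_mono (S.step_subset _ _) _
  have hstep : ∀ i n, G (i + 1) (n + 1) = S.step (G i n) (w i) := by
    intro i n
    simp only [G]
    rw [wordAt_succ', List.foldl_append, Nat.cast_succ, add_sub_add_right_eq_sub, sub_add_cancel]
    rfl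
  have hstab : ∀ i, ∃ N, ∀ n ≥ N, G i n = G i N := by
    intro i
    have hfin : (range (G i)).Finite := h.subset (range_subset_iff.2 (hG i))
    obtain ⟨_, ⟨N, rfl⟩, hN⟩ := hfin.exists_minimal (range_nonempty _)
    exact ⟨N, fun n hn => (hanti i hn).antisymm (hN ⟨n, rfl⟩ (hanti i hn))⟩
  choose N hN using hstab
  have hlim : ∀ i, S.step (G i (N i)) (w i) = G (i + 1) (N (i + 1)) := by
    intro i
    -- At a common large index both sequences are already stable.
    rw [← hN i (max (N i) (N (i + 1))) (le_max_left _ _), ← hstep,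
      hN (i + 1) _ ((le_max_right _ _).trans (Nat.le_succ _))]
  refine ⟨fun i => ⟨(⟨G i (N i), hG _ _⟩, w i), ?_⟩, fun i => Subtype.ext (hlim i), fun i => rfl⟩
  change (S.step (G i (N i)) (w i)).Nonempty
  rw [hlim]
  exact (hG _ _).1

theorem isSofic_of_finite_states (h : S.states.Finite) : S.IsSofic :=
  ⟨S.stepGraph h, fun _ => ⟨S.isPathLabel_of_mem_shiftSpace h, S.mem_shiftSpace_of_isPathLabel⟩⟩

end RotationalBeta

end

theorem theorem2 (S : RotationalBeta) (q : ℕ) (hq : 2 < q) (hζ : S.ζ ^ q = 1)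
    (hβ : IsPisot S.β)
    (hη₁ : S.η₁ ∈ IntermediateField.adjoin ℚ {S.ζ, (S.β : ℂ)})
    (hη₂ : S.η₂ ∈ IntermediateField.adjoin ℚ {S.ζ, (S.β : ℂ)})
    (hξ : S.ξ ∈ IntermediateField.adjoin ℚ {S.ζ, (S.β : ℂ)})
    (hcos : S.ζ + S.ζ⁻¹ ∈ IntermediateField.adjoin ℚ {(S.β : ℂ)}) :
    S.IsSofic := by
  have hre : S.ζ.re ∈ IntermediateField.adjoin ℚ {S.β} := by
    -- On the unit circle ζ⁻¹ is the conjugate of ζ.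
    have h1 : S.ζ + S.ζ⁻¹ = ((S.ζ.re * 2 : ℝ) : ℂ) := by
      rw [Complex.inv_eq_conj S.norm_ζ, Complex.add_conj, mul_comm]
    rw [h1, ofReal_mem_adjoin_iff] at hcos
    simpa using div_mem hcos (ofNat_mem _ 2 : (2 : ℝ) ∈ IntermediateField.adjoin ℚ {S.β})
  exact S.isSofic_of_finite_states
    (S.finite_states q (by omega) hζ hβ hη₁ hη₂ hξ hre)
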